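/- Let $n\ge 1$, and let $q_1,\dots,q_{n-1}$, $x_1,\dots,x_n$ and $t_w$ ($w\in S_n$) be independent variables. For $0\le k\le n$ let $\Delta_k(t\,|\,X_k)$ be the determinant of the tridiagonal $k\times k$ matrix with diagonal entries $x_1+t,\dots,x_k+t$, entries $q_1,\dots,q_{k-1}$ directly above the diagonal and entries $-1$ directly below it. Write $\Delta_n(t\,|\,X_n)=t^n+\sum_{i=1}^n\tilde e_i\,t^{n-i}$, and let $\tilde I_n$ be the ideal generated by the quantum elementary symmetric polynomials $\tilde e_1,\dots,\tilde e_n$ in $\mathbb{Q}[q_1,\dots,q_{n-1}][x_1,\dots,x_n]$. For $w\in S_n$ the quantum Schubert polynomial is $$\tilde{\mathfrak S}_w(x)=\partial^{(y)}_{ww_0}\Bigl(\prod_{k=1}^{n-1}\Delta_k(y_{n-k}\,|\,X_k)\Bigr)\Big|_{y=0},$$ where $w_0$ is the longest element of $S_n$ and $\partial^{(y)}_v$ is the divided difference operator in the variables $y_1,\dots,y_n$, i.e. $\partial_v=\partial_{a_1}\cdots\partial_{a_p}$ for a reduced word $v=s_{a_1}\cdots s_{a_p}$, with $\partial_i f=(f-s_if)/(y_i-y_{i+1})$.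 Let $\langle h\rangle\in\mathbb{Q}[q_1,\dots,q_{n-1}]$ denote the Grothendieck residue $\mathrm{Res}\left[\begin{smallmatrix}h\,dx_1\cdots dx_n\\ \tilde e_1,\dots,\tilde e_n\end{smallmatrix}\right]$ of $h\in\mathbb{Q}[q][x]$ with respect to $\tilde I_n$, relative to $\mathbb{Q}[q]$. Let $\mathcal H_n[q]$ be the $\mathbb{Q}[q]$-span of the monomials $x_1^{i_1}\cdots x_n^{i_n}$ with $0\le i_k\le n-k$ for all $k$, and for $f\in\mathbb{Q}[q][x]$ let $[f]$ be the projection of $f$ on $\mathcal H_n[q]$ along $\tilde I_n$ (so $[f]\in\mathcal H_n[q]$ and $f-[f]\in\tilde I_n$); apply $[\cdot]$ and $\langle\cdot\rangle$ to formal power series in the $t_w$ coefficient by coefficient. Let $$K(x,t)=\Bigl[\exp\Bigl(\sum_{w\in S_n}t_w\tilde{\mathfrak S}_w(x)\Bigr)\Bigr],\qquad \mathcal F(t)=\langle K(x,t)\rangle$$ be the kernel and the (toy) Gromov–Witten potential. Then for all $u,w,\tau\in S_n$ $$\langle\tilde{\mathfrak S}_u\,\tilde{\mathfrak S}_w\,\tilde{\mathfrak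 S}_\tau\rangle=\frac{\partial^3\mathcal F}{\partial t_u\,\partial t_w\,\partial t_\tau}(t)\Big|_{t=0}.$$ -/

import Mathlib

open scoped TensorProduct

noncomputable section

namespace QuantumSchubert

/-! ## Quantum elementary symmetric polynomials -/

/-- The determinant `Δ_k(t | x_1, …, x_k)` of the tridiagonal `k × k` matrix with diagonal entries
`x_i + t`, entries `q_1, …, q_{k-1}` above the diagonal and `-1` below the diagonal. -/
def tridiagDet {A : Type*} [CommRing A] (k : ℕ) (x : Fin k → A) (q : Fin (k - 1) → A) (t : A) : A :=
  Matrix.det (Matrix.of fun i j : Fin k =>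
    if i = j then x i + t
    else if h : (i : ℕ) + 1 = (j : ℕ) then q ⟨i, by omega⟩
    else if (j : ℕ) + 1 = (i : ℕ) then -1
    else 0)

/-- The ring `ℚ[q_1, …, q_{n-1}]`. -/
abbrev QRing (n : ℕ) : Type := MvPolynomial (Fin (n - 1)) ℚ

/-- The ring `ℚ[q_1, …, q_{n-1}][x_1, …, x_n]`. -/
abbrev XRing (n : ℕ) : Type := MvPolynomial (Fin n) (QRing n)

/-- The polynomial `Δ_k(t | X_k)` in the first `k` variables `x_1, …, x_k` of `XRing n`
(and in `q_1, …, q_{k-1}`), at an element `t` of an extension `ι : XRing n → A`. -/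
def Delta (n k : ℕ) (hk : k ≤ n) {A : Type*} [CommRing A] (ι : XRing n →+* A) (t : A) : A :=
  tridiagDet k
    (fun i => ι (MvPolynomial.X (Fin.castLE hk i)))
    (fun i => ι (MvPolynomial.C (MvPolynomial.X (Fin.castLE (by omega) i)))) t

/-- The quantum elementary symmetric polynomial `e_{i+1}(X_n | q_1, …, q_{n-1})`, for
`i = 0, …, n - 1`: the coefficient of `t ^ (n - (i + 1))` in `Δ_n(t | X_n)`. -/
def quantumElem (n : ℕ) (i : Fin n) : XRing n :=
  (Delta n n le_rfl (Polynomial.C : XRing n →+* Polynomial (XRing n)) Polynomial.X).coeff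
    (n - (i + 1))

/-- The ideal `Ĩ_n` generated by the quantum elementary symmetric polynomials. -/
def quantumIdeal (n : ℕ) : Ideal (XRing n) := Ideal.span (Set.range (quantumElem n))

/-! ## Divided differences -/

theorem sub_dvd_sub_swap {A : Type*} [CommRing A] {n : ℕ} (i j : Fin n)
    (f : MvPolynomial (Fin n) A) :
    (MvPolynomial.X i - MvPolynomial.X j) ∣ f - MvPolynomial.rename (Equiv.swap i j) f := by
  classical
  rw [← Ideal.mem_span_singleton, ← Ideal.Quotient.mk_eq_mk_iff_sub_mem]
  set I := Ideal.span {(MvPolynomial.X i - MvPolynomial.X j : MvPolynomial (Fin n) A)} with hI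
  have hij : Ideal.Quotient.mk I (MvPolynomial.X i) = Ideal.Quotient.mk I (MvPolynomial.X j) := by
    rw [Ideal.Quotient.mk_eq_mk_iff_sub_mem, hI]
    exact Ideal.mem_span_singleton_self _
  induction f using MvPolynomial.induction_on with
  | C a => simp
  | add p q hp hq => simp [hp, hq]
  | mul_X p k hp =>
    rw [map_mul, map_mul, map_mul, hp, MvPolynomial.rename_X]
    congr 1
    rcases eq_or_ne k i with rfl | hki
    · rw [Equiv.swap_apply_left, hij]
    · rcases eq_or_ne k j with rfl | hkj
      · rw [Equiv.swap_apply_right, hij]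
      · rw [Equiv.swap_apply_of_ne_of_ne hki hkj]

/-- The simple transposition exchanging `i + 1` and `i + 2` (positions `i` and `i + 1` when
counted from `0`). -/
def simpleTransposition (n : ℕ) (i : Fin (n - 1)) : Equiv.Perm (Fin n) :=
  Equiv.swap ⟨i, by omega⟩ ⟨i + 1, by omega⟩

/-- The divided difference `∂_i f = (f - s_i f) / (y_i - y_{i+1})`: the polynomial `g` with
`f - s_i f = (y_i - y_{i+1}) g`. -/
def dividedDiff {A : Type*} [CommRing A] (n : ℕ) (i : Fin (n - 1)) (f : MvPolynomial (Fin n) A) :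
    MvPolynomial (Fin n) A :=
  (sub_dvd_sub_swap (⟨i, by omega⟩ : Fin n) ⟨i + 1, by omega⟩ f).choose

/-- The word `a_1 ⋯ a_p` is a reduced word of `w`: `w = s_{a_1} ⋯ s_{a_p}` with `p` minimal. -/
def IsReducedWord {n : ℕ} (l : List (Fin (n - 1))) (w : Equiv.Perm (Fin n)) : Prop :=
  (l.map (simpleTransposition n)).prod = w ∧
    ∀ l' : List (Fin (n - 1)), (l'.map (simpleTransposition n)).prod = w → l.length ≤ l'.length

theorem exists_isReducedWord {n : ℕ} (w : Equiv.Perm (Fin n)) :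
    ∃ l : List (Fin (n - 1)), IsReducedWord l w := by
  classical
  have key : ∃ l : List (Fin (n - 1)), (l.map (simpleTransposition n)).prod = w := by
    rcases n with _ | m
    · exact ⟨[], Subsingleton.elim _ _⟩
    · have hw : w ∈ Submonoid.closure
          (Set.range fun i : Fin m => Equiv.swap i.castSucc i.succ) := by
        rw [Equiv.Perm.mclosure_swap_castSucc_succ]
        exact Submonoid.mem_top w
      induction hw using Submonoid.closure_induction with
      | mem x hx =>
        obtain ⟨i, rfl⟩ := hx
        exact ⟨[i], by simp [simpleTransposition]; rfl⟩
      | one => exact ⟨[], rfl⟩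
      | mul x y _ _ hx hy =>
        obtain ⟨l₁, rfl⟩ := hx
        obtain ⟨l₂, rfl⟩ := hy
        exact ⟨l₁ ++ l₂, by simp⟩
  have hne : ∃ p : ℕ, ∃ l : List (Fin (n - 1)),
      (l.map (simpleTransposition n)).prod = w ∧ l.length = p :=
    ⟨_, key.choose, key.choose_spec, rfl⟩
  obtain ⟨l, hl, hp⟩ := Nat.find_spec hne
  exact ⟨l, hl, fun l' hl' => hp ▸ Nat.find_min' hne ⟨l', hl', rfl⟩⟩

/-- The divided difference operator `∂_w = ∂_{a_1} ∘ ⋯ ∘ ∂_{a_p}` for a reduced word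
`a_1 ⋯ a_p` of `w` (by the braid relations it does not matter which one). -/
def dividedDiffPerm {A : Type*} [CommRing A] {n : ℕ} (w : Equiv.Perm (Fin n))
    (f : MvPolynomial (Fin n) A) : MvPolynomial (Fin n) A :=
  (exists_isReducedWord w).choose.foldr (dividedDiff n) f

/-! ## Quantum Schubert polynomials -/

/-- The quantum double Schubert polynomial of the longest element,
`∏_{k = 1}^{n - 1} Δ_k(y_{n-k} | X_k)`, as a polynomial in `y_1, …, y_n` over `XRing n`
(the index `i` below is `k - 1`). -/
def quantumDoubleSchubertTop (n : ℕ) : MvPolynomial (Fin n) (XRing n) :=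
  ∏ i : Fin (n - 1),
    Delta n (i + 1) (by omega) (MvPolynomial.C : XRing n →+* MvPolynomial (Fin n) (XRing n))
      (MvPolynomial.X ⟨n - 1 - (i + 1), by omega⟩)

/-- The quantum double Schubert polynomial `S̃_w(x, y) = ∂_{w w₀}^{(y)} S̃_{w₀}(x, y)`; the longest
element `w₀` is `Fin.revPerm`. -/
def quantumDoubleSchubert {n : ℕ} (w : Equiv.Perm (Fin n)) : MvPolynomial (Fin n) (XRing n) :=
  dividedDiffPerm (w * Fin.revPerm) (quantumDoubleSchubertTop n)

/-- The quantum Schubert polynomial `S̃_w(x)`, the specialization `y = 0` of `S̃_w(x, y)`. -/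
def quantumSchubert {n : ℕ} (w : Equiv.Perm (Fin n)) : XRing n :=
  MvPolynomial.constantCoeff (quantumDoubleSchubert w)

/-! ## Grothendieck residues -/

/-- The Grothendieck residue `φ(h) = Res [h dx_1 ⋯ dx_n / f_1, …, f_n]` of a sequence of `n`
polynomials `f` in `n` variables over `R` (with `R[x]/(f)` finite and free over `R`), in the
algebraic form of Scheja and Storch: `φ` is the `R`-linear form on `R[x]` that vanishes on the
ideal `(f)` and is dual to the Bezoutian, that is, if
`f_i(x) - f_i(y) = ∑_j a_{ij}(x, y) (x_j - y_j)`, then applying `φ` in the variables `x` to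
`det a(x, y)` gives `1` modulo `(f(y))`. The polynomials in `x` and `y` are the elements of
`R[x] ⊗ R[x]`. -/
def IsGrothendieckResidue {R : Type*} [CommRing R] {n : ℕ} (f : Fin n → MvPolynomial (Fin n) R)
    (φ : MvPolynomial (Fin n) R →ₗ[R] R) : Prop :=
  (∀ h ∈ Ideal.span (Set.range f), φ h = 0) ∧
  ∃ a : Matrix (Fin n) (Fin n) (MvPolynomial (Fin n) R ⊗[R] MvPolynomial (Fin n) R),
    (∀ i, f i ⊗ₜ[R] (1 : MvPolynomial (Fin n) R) - (1 : MvPolynomial (Fin n) R) ⊗ₜ[R] f i =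
      ∑ j, a i j *
        ((MvPolynomial.X j : MvPolynomial (Fin n) R) ⊗ₜ[R] (1 : MvPolynomial (Fin n) R) -
          (1 : MvPolynomial (Fin n) R) ⊗ₜ[R] (MvPolynomial.X j : MvPolynomial (Fin n) R))) ∧
    TensorProduct.lid R (MvPolynomial (Fin n) R)
        (LinearMap.rTensor (MvPolynomial (Fin n) R) φ a.det) - 1 ∈ Ideal.span (Set.range f)

open Classical in
/-- The Grothendieck residue of a sequence of polynomials, and `0` if there is none. -/
def grothendieckResidue {R : Type*} [CommRing R] {n : ℕ} (f : Fin n → MvPolynomial (Fin n) R) :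
    MvPolynomial (Fin n) R →ₗ[R] R :=
  if h : ∃ φ, IsGrothendieckResidue f φ then h.choose else 0

/-- The residue `⟨h⟩` with respect to `Ĩ_n`, that is, with respect to the generators
`e_1(X_n | q), …, e_n(X_n | q)`; it takes values in `ℚ[q_1, …, q_{n-1}]`. -/
def quantumResidue (n : ℕ) : XRing n →ₗ[QRing n] QRing n :=
  grothendieckResidue (quantumElem n)

/-! ## The kernel and the potential -/

/-- The module `H_n[q]` spanned over `ℚ[q_1, …, q_{n-1}]` by the monomials
`x_1^{i_1} ⋯ x_n^{i_n}` with `i_k ≤ n - k` for `k = 1, …, n`. -/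
def subStaircase (n : ℕ) : Submodule (QRing n) (XRing n) :=
  Submodule.span (QRing n)
    ((fun I : Fin n →₀ ℕ => (MvPolynomial.monomial I (1 : QRing n) : XRing n)) ''
      {I | ∀ k : Fin n, I k + (k + 1) ≤ n})

open Classical in
/-- The projection of `ℚ[q][x]` on `H_n[q]` along the ideal `Ĩ_n` (which is a complement of
`H_n[q]`): the element `g` of `H_n[q]` with `f ≡ g` modulo `Ĩ_n`. -/
def proj (n : ℕ) (f : XRing n) : XRing n :=
  if h : ∃ g ∈ subStaircase n, f - g ∈ quantumIdeal n then h.choose else 0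

/-- Apply a map to each coefficient of a formal power series. -/
def mapCoeff {σ A B : Type*} [Semiring A] (g : A → B) (F : MvPowerSeries σ A) :
    MvPowerSeries σ B :=
  fun m => g (MvPowerSeries.coeff m F)

/-- The formal power series `exp (∑_w t_w S̃_w(x))` in the variables `t_w`, `w ∈ S_n`, with
coefficients in `ℚ[q][x]`. -/
def expSeries (n : ℕ) : MvPowerSeries (Equiv.Perm (Fin n)) (XRing n) :=
  (PowerSeries.exp ℚ).subst
    (∑ w : Equiv.Perm (Fin n), MvPowerSeries.X w * MvPowerSeries.C (quantumSchubert w) :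
      MvPowerSeries (Equiv.Perm (Fin n)) (XRing n))

/-- The kernel `K(x, t) = [exp (∑_w t_w S̃_w(x))]`. -/
def kernel (n : ℕ) : MvPowerSeries (Equiv.Perm (Fin n)) (XRing n) :=
  mapCoeff (proj n) (expSeries n)

/-- The (toy) Gromov–Witten potential `F(t) = ⟨K(x, t)⟩`, the Grothendieck residue of the kernel
with respect to `Ĩ_n`. -/
def potential (n : ℕ) : MvPowerSeries (Equiv.Perm (Fin n)) (QRing n) :=
  mapCoeff (quantumResidue n) (kernel n)

/-- The partial derivative `∂/∂t_w` on formal power series in the `t_v`, `v ∈ S_n`. -/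
abbrev dt {n : ℕ} (w : Equiv.Perm (Fin n)) (G : MvPowerSeries (Equiv.Perm (Fin n)) (QRing n)) :
    MvPowerSeries (Equiv.Perm (Fin n)) (QRing n) :=
  MvPowerSeries.pderiv (QRing n) w G

end QuantumSchubert

end

/-! ### Derivatives of power series obtained by substitution. -/

namespace MvPowerSeries

variable {σ A R : Type*} [CommRing A] [CommRing R] [Algebra A R]

/-! The residue kills `quantumIdeal` and `f - proj n f` lies in it, so the residue does not see the
bracket: the potential is the residue, coefficient by coefficient, of exp(∑ t_w S̃_w)
(`potential_eq_mapCoeff`). Differentiation commutes with additive maps on coefficients, and three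
derivatives of the exponential bring down S̃_u S̃_w S̃_τ, the exponential itself being 1 at the
origin.

The real work is that every f has a representative in `subStaircase`; uniqueness is not needed. The
coefficients of Δ_n(t) - t^n lie in the ideal, hence so does its divided difference at -x_1, …,
-x_{k+1}. The classical product ∏ (x_i + t) vanishes at these points, and Δ_n differs from it only
in lower degree, so the result is -h_{n-k}(-x_1, …, -x_{k+1}) plus terms of lower degree in x
(`staircaseRelation_eq`). Its leading term is ±x_{k+1}^{n-k}, a unit multiple of a monomial, and
division by these relations over ℚ[q] leaves a remainder in the staircase. -/

theorem coeff_pow_eq_zero_of_degree_lt {g : MvPowerSeries σ R} (hg : constantCoeff g = 0)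
    {e : σ →₀ ℕ} {d : ℕ} (h : e.degree < d) : coeff e (g ^ d) = 0 := by
  apply coeff_of_lt_order
  refine lt_of_lt_of_le ?_ (le_order_pow_of_constantCoeff_eq_zero d hg)
  exact_mod_cast h

/-- The bound `N` is left free so that different coefficients can be expanded over one common range.
-/
theorem coeff_subst_eq_sum_range {g : MvPowerSeries σ R} (hg : constantCoeff g = 0)
    (f : PowerSeries A) {e : σ →₀ ℕ} {N : ℕ} (h : e.degree < N) :
    coeff e (f.subst g) = ∑ d ∈ Finset.range N, PowerSeries.coeff d f • coeff e (g ^ d) := by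
  rw [PowerSeries.coeff_subst (.of_constantCoeff_zero hg)]
  refine finsum_eq_sum_of_support_subset _ fun d hd => ?_
  rw [Finset.coe_range, Set.mem_Iio]
  by_contra! hN
  exact hd (by beta_reduce; rw [coeff_pow_eq_zero_of_degree_lt hg (h.trans_le hN), smul_zero])

/-- The chain rule for the substitution of a multivariate power series without constant term
in a univariate one. -/
theorem pderiv_subst {g : MvPowerSeries σ R} (hg : constantCoeff g = 0) (f : PowerSeries A)
    (i : σ) :
    pderiv R i (f.subst g) = (PowerSeries.derivative A f).subst g * pderiv R i g := by
  classical
  ext n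
  -- Differentiation raises the relevant degree by one; once the d = 0 term drops out, the range
  -- matches that of the right-hand side.
  have hL : (n + Finsupp.single i 1).degree < n.degree + 1 + 1 := by
    rw [map_add, Finsupp.degree_single]; omega
  rw [coeff_pderiv, coeff_subst_eq_sum_range hg f hL, Finset.sum_mul]
  simp_rw [smul_mul_assoc, ← coeff_pderiv, pderiv_pow]
  rw [Finset.sum_range_succ']
  conv_rhs => rw [coeff_mul]
  have hR : ∀ p ∈ Finset.HasAntidiagonal.antidiagonal n,
      coeff p.1 ((PowerSeries.derivative A f).subst g) * coeff p.2 (pderiv R i g) =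
        ∑ d ∈ Finset.range (n.degree + 1), PowerSeries.coeff d (PowerSeries.derivative A f) •
          (coeff p.1 (g ^ d) * coeff p.2 (pderiv R i g)) := by
    intro p hp
    have hp1 : p.1.degree < n.degree + 1 := by
      rw [← Finset.HasAntidiagonal.mem_antidiagonal.mp hp, map_add]; omega
    rw [coeff_subst_eq_sum_range hg _ hp1, Finset.sum_mul]
    simp_rw [smul_mul_assoc]
  rw [Finset.sum_congr rfl hR, Finset.sum_comm]
  simp_rw [← Finset.smul_sum, ← coeff_mul]
  simp only [Nat.cast_zero, zero_mul, map_zero, smul_zero, add_zero, Nat.add_sub_cancel]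
  refine Finset.sum_congr rfl fun d _ => ?_
  rw [PowerSeries.coeff_derivative, mul_assoc, ← nsmul_eq_mul, map_nsmul, mul_smul]
  congr 1
  rw [← Nat.cast_succ, ← nsmul_one, smul_assoc, one_smul]

/-- The mixed third derivative at the origin of `exp (∑ t_v a_v)`. -/
theorem constantCoeff_pderiv_exp_linear [Fintype σ] [Algebra ℚ R] (a : σ → R) (u w τ : σ) :
    constantCoeff (pderiv R u (pderiv R w (pderiv R τ
      ((PowerSeries.exp ℚ).subst (∑ v, X v * C (a v) : MvPowerSeries σ R))))) =
      a u * a w * a τ := by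
  classical
  set S : MvPowerSeries σ R := ∑ v, X v * C (a v) with hS
  have h0 : constantCoeff S = 0 := by simp [hS]
  have hdS : ∀ v, pderiv R v S = C (a v) := by
    intro v
    simp [hS, Derivation.leibniz, pderiv_X, Pi.single_apply]
  have hexp : ∀ v, pderiv R v ((PowerSeries.exp ℚ).subst S) =
      (PowerSeries.exp ℚ).subst S * C (a v) := by
    intro v
    rw [pderiv_subst h0, PowerSeries.derivative_exp, hdS]
  have hmul : ∀ v b (F : MvPowerSeries σ R), pderiv R v (F * C b) = pderiv R v F * C b := by
    intro v b F
    simp [Derivation.leibniz, mul_comm]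
  have hc : constantCoeff ((PowerSeries.exp ℚ).subst S) = 1 := by
    rw [← coeff_zero_eq_constantCoeff_apply,
      coeff_subst_eq_sum_range h0 _ (N := 1) (by simp)]
    simp
  rw [hexp, hmul, hexp, hmul, hmul, hexp]
  simp [hc]

end MvPowerSeries

/-! ### Coefficientwise maps and the vanishing of the residue on the ideal. -/

namespace QuantumSchubert

theorem pderiv_mapCoeff {σ M N : Type*} [CommSemiring M] [CommSemiring N] (φ : M →+ N) (i : σ)
    (F : MvPowerSeries σ M) :
    MvPowerSeries.pderiv N i (mapCoeff φ F) = mapCoeff φ (MvPowerSeries.pderiv M i F) := by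
  ext m
  rw [MvPowerSeries.coeff_pderiv]
  change φ _ * _ = φ (MvPowerSeries.coeff m _)
  rw [MvPowerSeries.coeff_pderiv, ← Nat.cast_succ, ← Nat.cast_succ, mul_comm, ← nsmul_eq_mul,
    mul_comm, ← nsmul_eq_mul, map_nsmul]

/-- This needs no existence of the residue: the default value 0 vanishes as well. -/
theorem quantumResidue_eq_zero_of_mem {n : ℕ} {h : XRing n} (hh : h ∈ quantumIdeal n) :
    quantumResidue n h = 0 := by
  unfold quantumResidue grothendieckResidue
  split_ifs with hex
  · exact hex.choose_spec.1 h hh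
  · rfl

end QuantumSchubert


/-! ### Divided differences without denominators. -/

noncomputable section

open scoped Polynomial

/-- The divided difference `f[x_0, …, x_k]` of the monomial `f = t ^ j`. -/
def dividedDiffMonomial {A : Type*} [CommRing A] (x : ℕ → A) : ℕ → ℕ → A
  | 0, j => x 0 ^ j
  | _ + 1, 0 => 0
  -- This is the recursion of h_{j-k}(x_0, …, x_k) according to whether the last variable occurs.
  | k + 1, j + 1 => dividedDiffMonomial x k j + x (k + 1) * dividedDiffMonomial x (k + 1) j

/-- The divided difference `f[x_0, …, x_k]` of a polynomial `f`. -/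
def dividedDiffPoly {A : Type*} [CommRing A] (x : ℕ → A) (k : ℕ) : A[X] →ₗ[A] A :=
  Polynomial.lsum fun j => LinearMap.mulRight A (dividedDiffMonomial x k j)

section dividedDiffPoly

variable {A : Type*} [CommRing A] (x : ℕ → A)

theorem dividedDiffPoly_apply (k : ℕ) (P : A[X]) :
    dividedDiffPoly x k P = ∑ j ∈ P.support, P.coeff j * dividedDiffMonomial x k j := rfl

theorem dividedDiffPoly_monomial (k j : ℕ) (a : A) :
    dividedDiffPoly x k (Polynomial.monomial j a) = a * dividedDiffMonomial x k j := by
  simp [dividedDiffPoly, Polynomial.lsum]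

theorem dividedDiffPoly_X_pow (k j : ℕ) :
    dividedDiffPoly x k (Polynomial.X ^ j) = dividedDiffMonomial x k j := by
  rw [← Polynomial.monomial_one_right_eq_X_pow, dividedDiffPoly_monomial, one_mul]

theorem dividedDiffPoly_zero_mul (P : A[X]) :
    dividedDiffPoly x 0 ((Polynomial.X - Polynomial.C (x 0)) * P) = 0 := by
  induction P using Polynomial.induction_on' with
  | add p q hp hq => rw [mul_add, map_add, hp, hq, add_zero]
  | monomial j a =>
    rw [sub_mul, Polynomial.X_mul_monomial, Polynomial.C_mul_monomial, map_sub,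
      dividedDiffPoly_monomial, dividedDiffPoly_monomial, dividedDiffMonomial, dividedDiffMonomial]
    ring

/-- On monomials this is the defining recursion, solved for its first term. -/
theorem dividedDiffPoly_succ_mul (k : ℕ) (P : A[X]) :
    dividedDiffPoly x (k + 1) ((Polynomial.X - Polynomial.C (x (k + 1))) * P) =
      dividedDiffPoly x k P := by
  induction P using Polynomial.induction_on' with
  | add p q hp hq => rw [mul_add, map_add, hp, hq, map_add]
  | monomial j a =>
    rw [sub_mul, Polynomial.X_mul_monomial, Polynomial.C_mul_monomial, map_sub,
      dividedDiffPoly_monomial, dividedDiffPoly_monomial, dividedDiffMonomial,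
      dividedDiffPoly_monomial]
    ring

theorem dividedDiffPoly_prod_mul (k : ℕ) (P : A[X]) :
    dividedDiffPoly x k
      ((∏ i ∈ Finset.range (k + 1), (Polynomial.X - Polynomial.C (x i))) * P) = 0 := by
  induction k with
  | zero => rw [Finset.prod_range_one, dividedDiffPoly_zero_mul]
  | succ k ih =>
    rw [Finset.prod_range_succ, mul_comm _ (Polynomial.X - _), mul_assoc,
      dividedDiffPoly_succ_mul, ih]

theorem dividedDiffPoly_mem {I : Ideal A} {P : A[X]} (h : ∀ j, P.coeff j ∈ I) (k : ℕ) :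
    dividedDiffPoly x k P ∈ I := by
  rw [dividedDiffPoly_apply]
  exact Ideal.sum_mem _ fun j _ => I.mul_mem_right _ (h j)

end dividedDiffPoly

/-! ### Joint degree in t and x. -/

/-- The polynomial `P` has total degree at most `d` jointly in its variable and in the variables
of its coefficients. -/
def JointDegreeLE {σ R : Type*} [CommRing R] (d : ℕ) (P : (MvPolynomial σ R)[X]) : Prop :=
  ∀ j c, (P.coeff j).coeff c ≠ 0 → c.degree + j ≤ d

namespace JointDegreeLE

variable {σ R : Type*} [CommRing R] {d e : ℕ} {P Q : (MvPolynomial σ R)[X]}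

theorem mono (h : JointDegreeLE d P) (hde : d ≤ e) : JointDegreeLE e P :=
  fun j c hc => (h j c hc).trans hde

theorem zero : JointDegreeLE d (0 : (MvPolynomial σ R)[X]) := fun j c hc => by simp at hc

theorem add (hP : JointDegreeLE d P) (hQ : JointDegreeLE d Q) : JointDegreeLE d (P + Q) := by
  intro j c hc
  rw [Polynomial.coeff_add, MvPolynomial.coeff_add] at hc
  by_cases h : (P.coeff j).coeff c = 0
  · exact hQ j c (by simpa [h] using hc)
  · exact hP j c h

theorem sum {ι : Type*} {s : Finset ι} {f : ι → (MvPolynomial σ R)[X]}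
    (h : ∀ i ∈ s, JointDegreeLE d (f i)) : JointDegreeLE d (∑ i ∈ s, f i) :=
  Finset.sum_induction f (JointDegreeLE d) (fun _ _ => add) zero h

theorem neg (hP : JointDegreeLE d P) : JointDegreeLE d (-P) := fun j c hc =>
  hP j c (by simpa using hc)

theorem units_smul (hP : JointDegreeLE d P) (u : ℤˣ) : JointDegreeLE d (u • P) := by
  rcases Int.units_eq_one_or u with rfl | rfl
  · rwa [one_smul]
  · rw [Units.neg_smul, one_smul]
    exact hP.neg

theorem mul (hP : JointDegreeLE d P) (hQ : JointDegreeLE e Q) : JointDegreeLE (d + e) (P * Q) := by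
  classical
  intro j c hc
  rw [Polynomial.coeff_mul, MvPolynomial.coeff_sum] at hc
  obtain ⟨p, hp, hpc⟩ := Finset.exists_ne_zero_of_sum_ne_zero hc
  rw [MvPolynomial.coeff_mul] at hpc
  obtain ⟨r, hr, hrc⟩ := Finset.exists_ne_zero_of_sum_ne_zero hpc
  have h1 := hP _ _ (left_ne_zero_of_mul hrc)
  have h2 := hQ _ _ (right_ne_zero_of_mul hrc)
  rw [Finset.HasAntidiagonal.mem_antidiagonal] at hp hr
  rw [← hp, ← hr, map_add]
  omega

theorem C_C (a : R) : JointDegreeLE 0 (Polynomial.C (MvPolynomial.C a : MvPolynomial σ R)) := by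
  classical
  intro j c hc
  rw [Polynomial.coeff_C] at hc
  split_ifs at hc with hj
  · rw [MvPolynomial.coeff_C] at hc
    split_ifs at hc with h0
    · simp [← h0, hj]
    · exact absurd rfl hc
  · simp at hc

theorem C_X_add_X (i : σ) :
    JointDegreeLE 1 (Polynomial.C (MvPolynomial.X i : MvPolynomial σ R) + Polynomial.X) := by
  classical
  apply add
  · intro j c hc
    rw [Polynomial.coeff_C] at hc
    split_ifs at hc with hj
    · rw [MvPolynomial.coeff_X] at hc
      split_ifs at hc with h0
      · simp [← h0, hj]
      · exact absurd rfl hc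
    · simp at hc
  · intro j c hc
    rw [Polynomial.coeff_X] at hc
    split_ifs at hc with hj
    · rw [MvPolynomial.coeff_one] at hc
      split_ifs at hc with h0
      · simp [← h0, ← hj]
      · exact absurd rfl hc
    · simp at hc

theorem prod {ι : Type*} {s : Finset ι} {f : ι → (MvPolynomial σ R)[X]} {D : ι → ℕ}
    (h : ∀ i ∈ s, JointDegreeLE (D i) (f i)) : JointDegreeLE (∑ i ∈ s, D i) (∏ i ∈ s, f i) := by
  classical
  induction s using Finset.induction_on with
  | empty => simpa using C_C (σ := σ) (1 : R)
  | insert a s ha ih =>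
    rw [Finset.prod_insert ha, Finset.sum_insert ha]
    exact (h a (Finset.mem_insert_self _ _)).mul
      (ih fun i hi => h i (Finset.mem_insert_of_mem hi))

/-- A permutation other than the identity moves some index, so its term has an off-diagonal factor,
of degree 0, and at most n - 1 factors of degree 1. -/
theorem det_sub_prod_diag {n : ℕ} {M : Matrix (Fin n) (Fin n) (MvPolynomial σ R)[X]}
    (hM : ∀ i j, JointDegreeLE (if i = j then 1 else 0) (M i j)) :
    JointDegreeLE (n - 1) (M.det - ∏ i, M i i) := by
  rw [Matrix.det_apply, ← Finset.add_sum_erase _ _ (Finset.mem_univ (1 : Equiv.Perm (Fin n)))]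
  simp only [Equiv.Perm.sign_one, one_smul, Equiv.Perm.coe_one, id_eq, add_sub_cancel_left]
  refine sum fun s hs => ?_
  obtain ⟨a, ha⟩ : ∃ a, s a ≠ a := by
    by_contra! h
    exact Finset.ne_of_mem_erase hs (Equiv.ext h)
  have hle : (∑ i : Fin n, if s i = i then 1 else 0) ≤ n - 1 := by
    rw [← Finset.add_sum_erase _ _ (Finset.mem_univ a), if_neg ha, zero_add]
    refine (Finset.sum_le_card_nsmul _ _ 1 fun i _ => by split_ifs <;> simp).trans ?_
    simp [Finset.card_erase_of_mem]
  exact ((prod fun i _ => hM (s i) i).mono hle).units_smul _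

end JointDegreeLE

end

/-! ### Relations in the ideal and their leading terms. -/

noncomputable section

namespace QuantumSchubert

open scoped Polynomial
open MvPolynomial

/-- The tridiagonal matrix with determinant `Δ_n(t | X_n)`. -/
def quantumMatrix (n : ℕ) : Matrix (Fin n) (Fin n) (XRing n)[X] :=
  Matrix.of fun i j : Fin n =>
    if i = j then Polynomial.C (X i : XRing n) + Polynomial.X
    else if h : (i : ℕ) + 1 = (j : ℕ) then
      Polynomial.C (C (X (⟨i, by omega⟩ : Fin (n - 1))) : XRing n)
    else if (j : ℕ) + 1 = (i : ℕ) then -1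
    else 0

/-- The polynomial `Δ_n(t | X_n)`, whose coefficients are the quantum elementary
symmetric polynomials. -/
def quantumChar (n : ℕ) : (XRing n)[X] := (quantumMatrix n).det

theorem quantumElem_eq_coeff (n : ℕ) (i : Fin n) :
    quantumElem n i = (quantumChar n).coeff (n - (i + 1)) := rfl

theorem jointDegreeLE_quantumMatrix {n : ℕ} (i j : Fin n) :
    JointDegreeLE (if i = j then 1 else 0) (quantumMatrix n i j) := by
  rw [quantumMatrix, Matrix.of_apply]
  split_ifs with h h' h''
  · exact JointDegreeLE.C_X_add_X _
  · exact JointDegreeLE.C_C _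
  · simpa using JointDegreeLE.C_C (σ := Fin n) (-1 : QRing n)
  · exact JointDegreeLE.zero

theorem jointDegreeLE_quantumChar_sub_prod (n : ℕ) :
    JointDegreeLE (n - 1)
      (quantumChar n - ∏ i : Fin n, (Polynomial.C (X i : XRing n) + Polynomial.X)) := by
  have h : ∏ i : Fin n, (Polynomial.C (X i : XRing n) + Polynomial.X) =
      ∏ i : Fin n, quantumMatrix n i i := by
    simp [quantumMatrix]
  rw [h]
  exact JointDegreeLE.det_sub_prod_diag jointDegreeLE_quantumMatrix

/-- Below degree n these coefficients are the generators; from n on they vanish, because Δ_n has the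
same coefficients there as a monic product of degree n. -/
theorem coeff_quantumChar_sub_X_pow_mem (n j : ℕ) :
    (quantumChar n - Polynomial.X ^ n).coeff j ∈ quantumIdeal n := by
  rw [Polynomial.coeff_sub, Polynomial.coeff_X_pow]
  rcases lt_or_ge j n with hj | hj
  · rw [if_neg hj.ne, sub_zero]
    refine Ideal.subset_span ⟨⟨n - 1 - j, by omega⟩, ?_⟩
    rw [quantumElem_eq_coeff]
    congr 1
    change n - (n - 1 - j + 1) = j
    omega
  -- For n = 0 the bound n - 1 truncates to 0 and does not exclude j = 0.
  · have hE : (quantumChar n - ∏ i : Fin n,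
        (Polynomial.C (X i : XRing n) + Polynomial.X)).coeff j = 0 ∨ n = 0 := by
      by_contra! h
      obtain ⟨c, hc⟩ := MvPolynomial.ne_zero_iff.mp h.1
      have := jointDegreeLE_quantumChar_sub_prod n j c hc
      omega
    rcases hE with hE | rfl
    · rw [Polynomial.coeff_sub, sub_eq_zero] at hE
      have hmonic : (∏ i : Fin n, (Polynomial.C (X i : XRing n) + Polynomial.X)).Monic :=
        Polynomial.monic_prod_of_monic _ _ fun i _ => by
          rw [add_comm]; exact Polynomial.monic_X_add_C _
      have hdeg : (∏ i : Fin n, (Polynomial.C (X i : XRing n) + Polynomial.X)).natDegree = n := by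
        rw [Polynomial.natDegree_prod_of_monic _ _ fun i _ => by
            rw [add_comm]; exact Polynomial.monic_X_add_C _,
          Finset.sum_congr rfl fun i _ => by
            rw [add_comm, Polynomial.natDegree_X_add_C]]
        simp
      rw [hE]
      split_ifs with hjn
      · have := hmonic.coeff_natDegree
        rw [hdeg] at this
        rw [hjn, this]
        simp
      · rw [Polynomial.coeff_eq_zero_of_natDegree_lt (by omega)]
        simp
    · rw [quantumChar, Matrix.det_isEmpty, Polynomial.coeff_one]
      simp

/-- The points `-x_1, -x_2, …`, extended by zero. -/
def negVar (n : ℕ) (i : ℕ) : XRing n := if h : i < n then -X ⟨i, h⟩ else 0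

theorem negVar_mul {n i : ℕ} (h : i < n) (f : XRing n) :
    negVar n i * f = -(X ⟨i, h⟩ * f) := by
  rw [negVar, dif_pos h]
  exact neg_mul _ f

theorem dividedDiffPoly_prod_negVar {n k : ℕ} (hk : k < n) :
    dividedDiffPoly (negVar n) k
      (∏ i : Fin n, (Polynomial.C (X i : XRing n) + Polynomial.X)) = 0 := by
  have h : (∏ i : Fin n, (Polynomial.C (X i : XRing n) + Polynomial.X)) =
      ∏ i ∈ Finset.range n, (Polynomial.X - Polynomial.C (negVar n i)) := by
    rw [← Fin.prod_univ_eq_prod_range]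
    refine Finset.prod_congr rfl fun i _ => ?_
    simp [negVar, add_comm]
  obtain ⟨m, rfl⟩ : ∃ m, n = k + 1 + m := ⟨n - (k + 1), by omega⟩
  rw [h, Finset.prod_range_add, dividedDiffPoly_prod_mul]

/-- The polynomial is h_{j-k}(-x_1, …, -x_{k+1}); the additive form of the degree also encodes that
it is 0 for j < k. -/
theorem dividedDiffMonomial_support {n : ℕ} (k j : ℕ) (c : Fin n →₀ ℕ)
    (hc : coeff c (dividedDiffMonomial (negVar n) k j) ≠ 0) :
    c.degree + k = j ∧ ∀ i : Fin n, k < i → c i = 0 := by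
  classical
  have hmul : ∀ (i : ℕ) (f : XRing n) (c : Fin n →₀ ℕ), coeff c (negVar n i * f) ≠ 0 →
      ∃ (h : i < n) (c' : Fin n →₀ ℕ), c = Finsupp.single ⟨i, h⟩ 1 + c' ∧ coeff c' f ≠ 0 := by
    intro i f c hc
    by_cases h : i < n
    · rw [negVar_mul h, coeff_neg, neg_ne_zero, coeff_X_mul'] at hc
      split_ifs at hc with hmem
      · refine ⟨h, _, ?_, hc⟩
        rw [add_tsub_cancel_of_le]
        rw [Finsupp.single_le_iff]
        exact Nat.one_le_iff_ne_zero.mpr (Finsupp.mem_support_iff.mp hmem)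
      · exact absurd rfl hc
    · simp [negVar, h] at hc
  induction k generalizing j c with
  | zero =>
    induction j generalizing c with
    | zero =>
      rw [dividedDiffMonomial, pow_zero, coeff_one] at hc
      split_ifs at hc with h
      · simp [← h]
      · exact absurd rfl hc
    | succ j ih =>
      rw [dividedDiffMonomial, pow_succ'] at hc
      obtain ⟨h, c', rfl, hc'⟩ := hmul _ _ _ hc
      obtain ⟨h1, h2⟩ := ih c' (by rwa [dividedDiffMonomial])
      refine ⟨by rw [map_add, Finsupp.degree_single]; omega, fun i hi => ?_⟩
      rw [Finsupp.add_apply, h2 i hi, Finsupp.single_eq_of_ne]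
      rintro rfl
      simp at hi
  | succ k ihk =>
    induction j generalizing c with
    | zero => simp [dividedDiffMonomial] at hc
    | succ j ih =>
      rw [dividedDiffMonomial, coeff_add] at hc
      by_cases h0 : coeff c (dividedDiffMonomial (negVar n) k j) = 0
      · rw [h0, zero_add] at hc
        obtain ⟨h, c', rfl, hc'⟩ := hmul _ _ _ hc
        obtain ⟨h1, h2⟩ := ih c' hc'
        refine ⟨by rw [map_add, Finsupp.degree_single]; omega, fun i hi => ?_⟩
        rw [Finsupp.add_apply, h2 i hi, Finsupp.single_eq_of_ne]
        rintro rfl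
        simp at hi
      · obtain ⟨h1, h2⟩ := ihk j c h0
        exact ⟨by omega, fun i hi => h2 i (by omega)⟩

/-- Only the second term of the recursion contributes a pure power of the last variable, with one
sign for each factor. -/
theorem dividedDiffMonomial_coeff {n : ℕ} (m k : ℕ) (hk : k < n) :
    coeff (Finsupp.single ⟨k, hk⟩ m) (dividedDiffMonomial (negVar n) k (m + k)) = (-1) ^ m := by
  classical
  have hX : ∀ (k : ℕ) (hk : k < n) (m : ℕ) (f : XRing n),
      coeff (Finsupp.single ⟨k, hk⟩ (m + 1)) (negVar n k * f) =
        -coeff (Finsupp.single ⟨k, hk⟩ m) f := by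
    intro k hk m f
    rw [negVar_mul hk, coeff_neg, add_comm m 1, Finsupp.single_add, coeff_X_mul]
  have hdiag : ∀ k, coeff (0 : Fin n →₀ ℕ) (dividedDiffMonomial (negVar n) k k) = 1 := by
    intro k
    induction k with
    | zero => simp [dividedDiffMonomial]
    | succ k ih =>
      rw [dividedDiffMonomial, coeff_add, ih, add_eq_left, ← not_ne_iff]
      intro h
      rw [← constantCoeff_eq, map_mul] at h
      have := (dividedDiffMonomial_support (k + 1) k (0 : Fin n →₀ ℕ)
        (right_ne_zero_of_mul h)).1
      omega
  induction m with
  | zero => simpa using hdiag k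
  | succ m ih =>
    rcases k with _ | k
    · rw [dividedDiffMonomial, add_zero, pow_succ', hX, pow_succ', neg_one_mul, ← ih,
        dividedDiffMonomial, add_zero]
    · rw [show m + 1 + (k + 1) = (m + (k + 1)) + 1 by omega, dividedDiffMonomial, coeff_add, hX,
        ih, pow_succ', neg_one_mul, add_eq_right, ← not_ne_iff]
      intro h
      simpa using (dividedDiffMonomial_support _ _ _ h).2 ⟨k + 1, hk⟩ (by simp)

/-- The element of `Ĩ_n` with leading monomial `x_{k+1} ^ (n - k)`. -/
def staircaseRelation (n k : ℕ) : XRing n :=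
  dividedDiffPoly (negVar n) k (quantumChar n - Polynomial.X ^ n)

theorem staircaseRelation_mem (n k : ℕ) : staircaseRelation n k ∈ quantumIdeal n :=
  dividedDiffPoly_mem _ (coeff_quantumChar_sub_X_pow_mem n) k

theorem staircaseRelation_eq {n k : ℕ} (hk : k < n) :
    staircaseRelation n k = dividedDiffPoly (negVar n) k
      (quantumChar n - ∏ i : Fin n, (Polynomial.C (X i : XRing n) + Polynomial.X)) -
        dividedDiffMonomial (negVar n) k n := by
  rw [staircaseRelation, map_sub, map_sub, dividedDiffPoly_X_pow, dividedDiffPoly_prod_negVar hk,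
    sub_zero]

/-- The coefficient of t^j has x-degree at most n - 1 - j, and t^j is replaced by a form of degree j
- k. -/
theorem degree_add_lt_of_coeff_dividedDiffPoly_ne_zero {n k : ℕ} (hk : k < n) (c : Fin n →₀ ℕ)
    (hc : coeff c (dividedDiffPoly (negVar n) k
      (quantumChar n - ∏ i : Fin n, (Polynomial.C (X i : XRing n) + Polynomial.X))) ≠ 0) :
    c.degree + k < n := by
  classical
  rw [dividedDiffPoly_apply, coeff_sum] at hc
  obtain ⟨j, _, hj⟩ := Finset.exists_ne_zero_of_sum_ne_zero hc
  rw [coeff_mul] at hj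
  obtain ⟨p, hp, hpc⟩ := Finset.exists_ne_zero_of_sum_ne_zero hj
  have h1 := jointDegreeLE_quantumChar_sub_prod n _ _ (left_ne_zero_of_mul hpc)
  have h2 := (dividedDiffMonomial_support _ _ _ (right_ne_zero_of_mul hpc)).1
  rw [← Finset.HasAntidiagonal.mem_antidiagonal.mp hp, map_add]
  omega

/-! ### Monomial order and division with remainder. -/

/-- The degree-lexicographic order with `x_1 < x_2 < ⋯ < x_n`. -/
def degLexRev (n : ℕ) : MonomialOrder (Fin n) :=
  -- By default the first variable is the largest; dualizing makes x_{k+1} dominate x_1, …, x_k.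
  MonomialOrder.degLex (σ := (Fin n)ᵒᵈ)

open scoped MonomialOrder

theorem degLexRev_lt_of_degree_lt {n : ℕ} {c d : Fin n →₀ ℕ} (h : c.degree < d.degree) :
    c ≺[degLexRev n] d :=
  Finsupp.DegLex.lt_iff (α := (Fin n)ᵒᵈ).mpr (Or.inl h)

theorem degLexRev_lt_single {n : ℕ} {c : Fin n →₀ ℕ} {k : Fin n} {m : ℕ} (hd : c.degree = m)
    (hs : ∀ i, k < i → c i = 0) (hne : c ≠ Finsupp.single k m) :
    c ≺[degLexRev n] Finsupp.single k m := by
  refine Finsupp.DegLex.lt_iff (α := (Fin n)ᵒᵈ).mpr (Or.inr ⟨?_, ?_⟩)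
  · exact hd.trans (Finsupp.degree_single k m).symm
  · have hck : c k < m := by
      refine lt_of_le_of_ne (hd ▸ Finsupp.le_degree k c) fun h => hne ?_
      have hle : Finsupp.single k m ≤ c := by rw [Finsupp.single_le_iff, h]
      have hadd := congrArg Finsupp.degree (add_tsub_cancel_of_le hle)
      rw [map_add, Finsupp.degree_single, hd, add_eq_left, Finsupp.degree_eq_zero_iff] at hadd
      rw [← add_tsub_cancel_of_le hle, hadd, add_zero]
    refine Finsupp.Lex.lt_iff.mpr ⟨OrderDual.toDual k, fun i hi => ?_, ?_⟩
    · have hki : k < OrderDual.ofDual i := hi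
      exact (hs _ hki).trans (Finsupp.single_eq_of_ne hki.ne').symm
    · exact hck.trans_eq Finsupp.single_eq_same.symm

theorem staircaseRelation_coeff {n : ℕ} (k : Fin n) :
    coeff (Finsupp.single k (n - k)) (staircaseRelation n k) = -(-1) ^ (n - k : ℕ) := by
  rw [staircaseRelation_eq k.2, coeff_sub]
  have h0 : coeff (Finsupp.single k (n - k)) (dividedDiffPoly (negVar n) k
      (quantumChar n - ∏ i : Fin n, (Polynomial.C (X i : XRing n) + Polynomial.X))) = 0 := by
    by_contra h
    have := degree_add_lt_of_coeff_dividedDiffPoly_ne_zero k.2 _ h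
    rw [Finsupp.degree_single] at this
    omega
  have h1 := dividedDiffMonomial_coeff (n - k) k k.2
  rw [Nat.sub_add_cancel k.2.le] at h1
  rw [h0, zero_sub, h1]

theorem degree_staircaseRelation {n : ℕ} (k : Fin n) :
    (degLexRev n).degree (staircaseRelation n k) = Finsupp.single k (n - k) := by
  apply (degLexRev n).toSyn.injective
  apply le_antisymm
  · rw [MonomialOrder.degree_le_iff]
    intro c hc
    rw [mem_support_iff, staircaseRelation_eq k.2, coeff_sub] at hc
    by_cases h : coeff c (dividedDiffPoly (negVar n) k
      (quantumChar n - ∏ i : Fin n, (Polynomial.C (X i : XRing n) + Polynomial.X))) = 0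
    · rw [h, zero_sub, neg_ne_zero] at hc
      obtain ⟨h1, h2⟩ := dividedDiffMonomial_support _ _ _ hc
      by_cases hne : c = Finsupp.single k (n - k)
      · rw [hne]
      · exact (degLexRev_lt_single (by omega) (fun i hi => h2 i hi) hne).le
    · have := degree_add_lt_of_coeff_dividedDiffPoly_ne_zero k.2 _ h
      refine (degLexRev_lt_of_degree_lt ?_).le
      rw [Finsupp.degree_single]
      omega
  · apply MonomialOrder.le_degree
    rw [mem_support_iff, staircaseRelation_coeff]
    exact neg_ne_zero.mpr (pow_ne_zero _ (neg_ne_zero.mpr one_ne_zero))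

/-- The division with remainder: `H_n[q]` and `Ĩ_n` span `ℚ[q][x]`. -/
theorem exists_mem_subStaircase_sub_mem (n : ℕ) (f : XRing n) :
    ∃ g ∈ subStaircase n, f - g ∈ quantumIdeal n := by
  obtain ⟨a, r, hf, -, hr⟩ := (degLexRev n).div (b := fun k : Fin n => staircaseRelation n k)
    (fun k => by
      rw [MonomialOrder.leadingCoeff, degree_staircaseRelation, staircaseRelation_coeff]
      exact ((isUnit_one.neg).pow _).neg) f
  refine ⟨r, ?_, ?_⟩
  · rw [r.as_sum]
    refine Submodule.sum_mem _ fun c hc => ?_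
    rw [← mul_one (coeff c r), ← smul_eq_mul, ← smul_monomial]
    refine Submodule.smul_mem _ _ (Submodule.subset_span ⟨c, fun k => ?_, rfl⟩)
    -- No monomial of the remainder is divisible by x_{k+1}^{n-k}, which is the staircase condition
    -- on its exponents.
    have := hr c hc k
    rw [degree_staircaseRelation, Finsupp.single_le_iff] at this
    omega
  · rw [hf, add_sub_cancel_right, Finsupp.linearCombination_apply]
    exact Submodule.sum_mem _ fun k _ => Ideal.mul_mem_left _ _ (staircaseRelation_mem n k)

/-- Existence of a representative rules out the default value of `proj`. -/
theorem sub_proj_mem (n : ℕ) (f : XRing n) : f - proj n f ∈ quantumIdeal n := by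
  have h := exists_mem_subStaircase_sub_mem n f
  rw [proj, dif_pos h]
  exact h.choose_spec.2

theorem quantumResidue_proj (n : ℕ) (f : XRing n) :
    quantumResidue n (proj n f) = quantumResidue n f := by
  have h := quantumResidue_eq_zero_of_mem (sub_proj_mem n f)
  rw [map_sub, sub_eq_zero] at h
  exact h.symm

theorem potential_eq_mapCoeff (n : ℕ) :
    potential n = mapCoeff (quantumResidue n).toAddMonoidHom (expSeries n) := by
  ext m : 1
  exact quantumResidue_proj n _

end QuantumSchubert

end

theorem corollaryc2p3 (n : ℕ) (u w τ : Equiv.Perm (Fin n)) :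
    QuantumSchubert.quantumResidue n
        (QuantumSchubert.quantumSchubert u * QuantumSchubert.quantumSchubert w *
          QuantumSchubert.quantumSchubert τ) =
      MvPowerSeries.constantCoeff
        (QuantumSchubert.dt u (QuantumSchubert.dt w
          (QuantumSchubert.dt τ (QuantumSchubert.potential n)))) := by
  rw [QuantumSchubert.potential_eq_mapCoeff]
  unfold QuantumSchubert.dt
  rw [QuantumSchubert.pderiv_mapCoeff, QuantumSchubert.pderiv_mapCoeff,
    QuantumSchubert.pderiv_mapCoeff,
    ← MvPowerSeries.constantCoeff_pderiv_exp_linear QuantumSchubert.quantumSchubert u w τ]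
  -- The constant coefficient of a coefficientwise image is the residue of the constant coefficient.
  rfl
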